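/- Let $K$ be a field, let $A$ be a finite-dimensional $K$-algebra and let $M$ be a finite-dimensional left $A$-module. Let $\mathrm{add}\,M$ be the class of all $A$-modules isomorphic to a direct summand of $M^n$ for some $n\ge 0$. Assume that the algebra $\mathrm{End}_A(M)$ is hereditary, i.e. submodules of finitely generated projective $\mathrm{End}_A(M)$-modules are projective. Then the bimodule ${}_AM_{\mathrm{End}_A(M)}$ is tilting if and only if there is an exact sequence of $A$-modules $$0\to A\xrightarrow{\ f\ } M_0\to M_1\to 0$$ with $M_0,M_1\in\mathrm{add}\,M$ such that $f$ is a minimal left $\mathrm{add}\,M$-approximation. Here $f:A\to M_0$ is a left $\mathrm{add}\,M$-approximation if $M_0\in\mathrm{add}\,M$ and every homomorphism from $A$ to a module $D'\in\mathrm{add}\,M$ factors through $f$; it is minimal if every endomorphism $g$ of $M_0$ with $gf=f$ is an isomorphism. For a finite-dimensional algebra $B$, an $A$-$B$-bimodule $T$ is called tilting if the canonical map $B\to\mathrm{End}_A(T)^{\mathrm{op}}$, $b\mapsto(x\mapsto xb)$, is an isomorphism and ${}_AT$ is a (generalized) tilting module, that is: ${}_AT$ has finite projective dimension, $\mathrm{Ext}^i_A(T,T)=0$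 for all $i>0$, and there is an exact sequence $0\to A\to T^0\to T^1\to\cdots\to T^s\to 0$ for some $s\ge 0$ with all $T^i\in\mathrm{add}\,T$. For $T=M$ one takes $B=\mathrm{End}_A(M)^{\mathrm{op}}$, so that $xb=b(x)$. -/

import Mathlib

open CategoryTheory

universe u

/-- A ring `R` is (left) hereditary: every submodule of a finitely generated projective left
`R`-module is projective. Used below for finite-dimensional algebras, where this is the same as
global dimension at most one, and is left-right symmetric. -/
def IsHereditary (R : Type u) [Ring R] : Prop :=
  ∀ (P : Type u) [AddCommGroup P] [Module R P] [Module.Finite R P] [Module.Projective R P]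
    (N : Submodule R P), Module.Projective R N

section Add

variable (A : Type u) [Ring A] (M : Type u) [AddCommGroup M] [Module A M]

/-- `N` belongs to `add M`: it is (isomorphic to) a direct summand of a finite direct sum of
copies of `M`. -/
def InAdd (N : Type u) [AddCommGroup N] [Module A N] : Prop :=
  ∃ (n : ℕ) (i : N →ₗ[A] (Fin n → M)) (p : (Fin n → M) →ₗ[A] N), p ∘ₗ i = LinearMap.id

/-- `f : X → D` is a left `add M`-approximation of `X`: `D` is in `add M` and
`Hom(f, D') : Hom(D, D') → Hom(X, D')` is surjective for every `D'` in `add M`. -/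
def IsLeftAddApproximation {X D : Type u} [AddCommGroup X] [Module A X]
    [AddCommGroup D] [Module A D] (f : X →ₗ[A] D) : Prop :=
  InAdd A M D ∧
    ∀ (D' : Type u) [AddCommGroup D'] [Module A D'], InAdd A M D' →
      ∀ h : X →ₗ[A] D', ∃ g : D →ₗ[A] D', g ∘ₗ f = h

/-- `f : X → Y` is left minimal: every endomorphism `g` of `Y` with `g f = f` is an
isomorphism. -/
def IsLeftMinimal {A : Type u} [Ring A] {X Y : Type u} [AddCommGroup X] [Module A X]
    [AddCommGroup Y] [Module A Y] (f : X →ₗ[A] Y) : Prop :=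
  ∀ g : Y →ₗ[A] Y, g ∘ₗ f = f → Function.Bijective g

/-- There is an exact sequence `0 → A → T⁰ → T¹ → ⋯ → Tˢ → 0` of left `A`-modules, for some
`s ≥ 0`, with every `Tⁱ` in `add M`. (The sequence is continued by zero modules.) -/
def HasFiniteAddCoresolution : Prop :=
  ∃ (s : ℕ) (T : ℕ → ModuleCat.{u} A) (ε : A →ₗ[A] T 0) (d : ∀ i, T i →ₗ[A] T (i + 1)),
    (∀ i, InAdd A M (T i)) ∧ (∀ i, s < i → Subsingleton (T i)) ∧
    Function.Injective ε ∧ Function.Exact ε (d 0) ∧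
    ∀ i, Function.Exact (d i) (d (i + 1))

/-- `M` is a (generalized) tilting `A`-module: it has finite projective dimension, has no
self-extensions in positive degrees, and `A` has a finite `add M`-coresolution. -/
structure IsTiltingModule : Prop where
  finite_projectiveDimension : ∃ n : ℕ, HasProjectiveDimensionLE (ModuleCat.of A M) n
  ext_eq_zero : ∀ i : ℕ, 0 < i →
    Subsingleton (Abelian.Ext.{u} (ModuleCat.of A M) (ModuleCat.of A M) i)
  coresolution : HasFiniteAddCoresolution A M

/-- Let `M` be an `A`-`B`-bimodule. The right `B`-action is given as a left action, commuting with
that of `A`, of the ring `E = Bᵒᵖ`. The bimodule `M` is tilting if `M` is a tilting `A`-module and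
the canonical map `B → End_A(M)ᵒᵖ`, `b ↦ (x ↦ x b)`, which is the canonical map
`E → End_A(M)`, `e ↦ (x ↦ e x)`, is an isomorphism. -/
structure IsTiltingBimodule (E : Type u) [Ring E] [Module E M] [SMulCommClass E A M] : Prop where
  isTiltingModule : IsTiltingModule A M
  bijective_toModuleEnd : Function.Bijective (Module.toModuleEnd A (S := E) M)

end Add

/-! ### Duality between `add M` and projective modules over `End(M)`. -/

section AddClosure

variable {A : Type u} [Ring A] {M : Type u} [AddCommGroup M] [Module A M]

/-! Write E = End_A(M). The functor Hom_A(-, M) is fully faithful and contravariant from add M to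
finitely generated projective E-modules, so heredity of E constrains exact sequences in add M.

From tilting to the sequence: Hom(-, M) turns X → Y → Z → 0 in add M into a left exact sequence
whose last map has projective image, so it splits, and dualizing splits Y → Z
(`IsHereditary.exists_section`). A finite coresolution of A thus collapses from the right to 0 → A →
T⁰ → Z → 0 with Z in add M. Vanishing of Ext¹(Z, M) makes A → T⁰ an approximation, and a summand of
T⁰ makes it minimal.

Conversely, the approximation sequence makes Hom(-, M) fully faithful on finite free modules too,
and gives Ext¹_E(Hom(Aᵏ, M), Hom(Aⁿ, M)) = 0. For a presentation Aᵏ → Aⁿ → M → 0, the Happel–Ringel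
argument (`IsHereditary.exists_range_decomposition`) applied to Hom(Aⁿ, M) → Hom(Aᵏ, M) dualizes to
a factorization of the identity of the syzygy of M through Aⁿ × Aᵏ. The syzygy is therefore
projective, and the same formula extends its maps to M over Aⁿ; hence pd M ≤ 1 and M is rigid.
Minimality is not needed here. -/

theorem InAdd.of_retract {N N' : Type u} [AddCommGroup N] [Module A N] [AddCommGroup N']
    [Module A N'] (h : InAdd A M N) (i : N' →ₗ[A] N) (p : N →ₗ[A] N')
    (hpi : p ∘ₗ i = LinearMap.id) : InAdd A M N' := by
  obtain ⟨n, j, q, hqj⟩ := h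
  refine ⟨n, j ∘ₗ i, p ∘ₗ q, ?_⟩
  rw [LinearMap.comp_assoc, ← LinearMap.comp_assoc i, hqj, LinearMap.id_comp, hpi]

theorem InAdd.of_subsingleton {N : Type u} [AddCommGroup N] [Module A N] [Subsingleton N] :
    InAdd A M N :=
  ⟨0, 0, 0, LinearMap.ext fun _ => Subsingleton.elim _ _⟩

theorem inAdd_self : InAdd A M M :=
  ⟨1, LinearMap.pi fun _ => LinearMap.id, LinearMap.proj 0, rfl⟩

/-- Homomorphisms to `M` separate the points of a module in `add M`. -/
theorem InAdd.eq_of_forall {N : Type u} [AddCommGroup N] [Module A N] (hN : InAdd A M N)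
    {y z : N} (h : ∀ φ : N →ₗ[A] M, φ y = φ z) : y = z := by
  obtain ⟨n, i, p, hpi⟩ := hN
  have key : i y = i z := funext fun t => h (LinearMap.proj t ∘ₗ i)
  rw [← LinearMap.id_apply (R := A) y, ← LinearMap.id_apply (R := A) z, ← hpi]
  exact congrArg p key

/-- A dual basis: the coordinates of the embedding into Mⁿ generate Hom(N, M) over `End(M)`, with
coefficients linear in φ. -/
theorem InAdd.hom_eq_sum {N : Type u} [AddCommGroup N] [Module A N] {n : ℕ}
    {i : N →ₗ[A] (Fin n → M)} {p : (Fin n → M) →ₗ[A] N} (hpi : p ∘ₗ i = LinearMap.id)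
    (φ : N →ₗ[A] M) :
    ∑ t, (φ ∘ₗ p ∘ₗ LinearMap.single A (fun _ => M) t : Module.End A M) •
      (LinearMap.proj t ∘ₗ i) = φ := by
  ext y
  conv_rhs => rw [← LinearMap.id_apply (R := A) y, ← hpi, LinearMap.comp_apply,
    ← LinearMap.sum_single_apply _ (i y), map_sum, map_sum]
  simp

/-- Every `End(M)`-linear functional `Hom(N, M) → M` is an evaluation, for `N` in `add M`. -/
theorem InAdd.exists_eval {N : Type u} [AddCommGroup N] [Module A N] (hN : InAdd A M N)
    (θ : (N →ₗ[A] M) →ₗ[Module.End A M] M) : ∃ y : N, ∀ φ, θ φ = φ y := by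
  obtain ⟨n, i, p, hpi⟩ := hN
  refine ⟨p fun t => θ (LinearMap.proj t ∘ₗ i), fun φ => ?_⟩
  conv_lhs => rw [← InAdd.hom_eq_sum hpi φ]
  rw [← LinearMap.sum_single_apply _ fun t => θ (LinearMap.proj t ∘ₗ i)]
  simp only [map_sum, map_smul]
  rfl

theorem InAdd.exists_hom_retract {N : Type u} [AddCommGroup N] [Module A N] (hN : InAdd A M N) :
    ∃ (n : ℕ) (s : (N →ₗ[A] M) →ₗ[Module.End A M] (Fin n → Module.End A M))
      (q : (Fin n → Module.End A M) →ₗ[Module.End A M] (N →ₗ[A] M)), q ∘ₗ s = LinearMap.id := by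
  obtain ⟨n, i, p, hpi⟩ := hN
  refine ⟨n, ⟨⟨fun φ t => φ ∘ₗ p ∘ₗ LinearMap.single A (fun _ => M) t, fun _ _ => rfl⟩,
    fun _ _ => rfl⟩, Fintype.linearCombination _ fun t => LinearMap.proj t ∘ₗ i, ?_⟩
  exact LinearMap.ext fun φ => InAdd.hom_eq_sum hpi φ

theorem InAdd.projective_hom {N : Type u} [AddCommGroup N] [Module A N] (hN : InAdd A M N) :
    Module.Projective (Module.End A M) (N →ₗ[A] M) := by
  obtain ⟨n, s, q, h⟩ := hN.exists_hom_retract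
  exact Module.Projective.of_split s q h

theorem InAdd.finite_hom {N : Type u} [AddCommGroup N] [Module A N] (hN : InAdd A M N) :
    Module.Finite (Module.End A M) (N →ₗ[A] M) := by
  obtain ⟨n, s, q, h⟩ := hN.exists_hom_retract
  exact Module.Finite.of_surjective q fun φ => ⟨s φ, LinearMap.congr_fun h φ⟩

end AddClosure

/-! ### Splitting of coresolutions over a hereditary endomorphism ring. -/

section Coresolution

variable {A : Type u} [Ring A] {M : Type u} [AddCommGroup M] [Module A M]

/-- Precomposition with an `A`-linear map, as a map of `End(M)`-modules. -/
def homPrecomp {X Y : Type u} [AddCommGroup X] [Module A X] [AddCommGroup Y] [Module A Y]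
    (e : X →ₗ[A] Y) : (Y →ₗ[A] M) →ₗ[Module.End A M] (X →ₗ[A] M) where
  toFun φ := φ ∘ₗ e
  map_add' _ _ := rfl
  map_smul' _ _ := rfl

@[simp]
theorem homPrecomp_apply {X Y : Type u} [AddCommGroup X] [Module A X] [AddCommGroup Y]
    [Module A Y] (e : X →ₗ[A] Y) (φ : Y →ₗ[A] M) : homPrecomp e φ = φ ∘ₗ e :=
  rfl

/-- An `A`-linear map which vanishes on the kernel of a surjection factors through it. -/
theorem LinearMap.exists_comp_eq_of_exact {X Y Z N : Type*} [AddCommGroup X] [Module A X]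
    [AddCommGroup Y] [Module A Y] [AddCommGroup Z] [Module A Z] [AddCommGroup N] [Module A N]
    {d : X →ₗ[A] Y} {e : Y →ₗ[A] Z} (hde : Function.Exact d e) (he : Function.Surjective e)
    (φ : Y →ₗ[A] N) (hφ : φ ∘ₗ d = 0) : ∃ ψ : Z →ₗ[A] N, ψ ∘ₗ e = φ := by
  have hk : LinearMap.ker e ≤ LinearMap.ker φ := by
    intro y hy
    obtain ⟨x, rfl⟩ := (hde y).1 hy
    exact LinearMap.congr_fun hφ x
  refine ⟨(LinearMap.ker e).liftQ φ hk ∘ₗ (e.quotKerEquivOfSurjective he).symm.toLinearMap,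
    LinearMap.ext fun y => ?_⟩
  have : (e.quotKerEquivOfSurjective he).symm (e y) = (LinearMap.ker e).mkQ y := by
    rw [LinearEquiv.symm_apply_eq]
    rfl
  simp [this]

/-- If `End(M)` is hereditary, an exact sequence `X → Y → Z → 0` in `add M` splits at `Z`. -/
theorem IsHereditary.exists_section (hE : IsHereditary (Module.End A M))
    {X Y Z : Type u} [AddCommGroup X] [Module A X] [AddCommGroup Y] [Module A Y]
    [AddCommGroup Z] [Module A Z] (hX : InAdd A M X) (hY : InAdd A M Y) (hZ : InAdd A M Z)
    {d : X →ₗ[A] Y} {e : Y →ₗ[A] Z} (hde : Function.Exact d e) (he : Function.Surjective e) :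
    ∃ s : Z →ₗ[A] Y, e ∘ₗ s = LinearMap.id := by
  have := hX.projective_hom
  have := hX.finite_hom
  have := hE (X →ₗ[A] M) (LinearMap.range (homPrecomp (M := M) d))
  obtain ⟨t, ht⟩ := Module.projective_lifting_property
    (homPrecomp (M := M) d).rangeRestrict LinearMap.id (LinearMap.surjective_rangeRestrict _)
  have hinj : Function.Injective (homPrecomp (M := M) e) := fun φ ψ h =>
    LinearMap.ext fun z => by
      obtain ⟨y, rfl⟩ := he z
      exact LinearMap.congr_fun h y
  -- Subtracting the part seen by `t` leaves a map that kills the image of `d`; this yields a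
  -- retraction `r` of `homPrecomp e`.
  have hfac (φ : Y →ₗ[A] M) : ∃ ψ : Z →ₗ[A] M,
      homPrecomp e ψ = φ - t ((homPrecomp (M := M) d).rangeRestrict φ) := by
    apply LinearMap.exists_comp_eq_of_exact hde he
    have := congrArg Subtype.val
      (LinearMap.congr_fun ht ((homPrecomp (M := M) d).rangeRestrict φ))
    change homPrecomp d (t _) = homPrecomp d φ at this
    change homPrecomp d (φ - _) = 0
    rw [map_sub, this, sub_self]
  choose r hr using hfac
  have hre (ψ : Z →ₗ[A] M) : r (homPrecomp e ψ) = ψ := by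
    apply hinj
    rw [hr]
    have : (homPrecomp (M := M) d).rangeRestrict (homPrecomp e ψ) = 0 := by
      apply Subtype.ext
      ext x
      change ψ (e (d x)) = 0
      rw [hde.apply_apply_eq_zero, map_zero]
    rw [this, map_zero, sub_zero]
  have hradd (φ φ' : Y →ₗ[A] M) : r (φ + φ') = r φ + r φ' := by
    apply hinj
    simp only [hr, map_add]
    abel
  have hrsmul (c : Module.End A M) (φ : Y →ₗ[A] M) : r (c • φ) = c • r φ := by
    apply hinj
    simp only [hr, map_smul, smul_sub]
  -- Full faithfulness on `add M`: `r` is precomposition with a map `s`, which is the section.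
  have heval (z : Z) : ∃ y : Y, ∀ φ : Y →ₗ[A] M, r φ z = φ y := by
    refine hY.exists_eval ⟨⟨fun φ => r φ z, fun φ φ' => ?_⟩, fun c φ => ?_⟩
    · rw [hradd]; rfl
    · simp only [hrsmul]; rfl
  choose s hs using heval
  refine ⟨⟨⟨s, fun z z' => hY.eq_of_forall fun φ => ?_⟩, fun a z => hY.eq_of_forall fun φ => ?_⟩,
    LinearMap.ext fun z => hZ.eq_of_forall fun ψ => ?_⟩
  · rw [← hs, map_add, map_add, hs, hs]
  · simp only [RingHom.id_apply]
    rw [← hs, map_smul, map_smul, hs]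
  · change ψ (e (s z)) = ψ z
    rw [← hre ψ, hs (z := z) (homPrecomp e ψ), hre]
    rfl

/-- If `End(M)` is hereditary, all cosyzygies of a finite coresolution in `add M` which starts
with an arbitrary module lie in `add M`, from the second one on. -/
theorem IsHereditary.inAdd_range (hE : IsHereditary (Module.End A M)) {s : ℕ}
    {T : ℕ → ModuleCat.{u} A} {d : ∀ i, T i →ₗ[A] T (i + 1)} (hT : ∀ i, InAdd A M (T i))
    (hs : ∀ i, s < i → Subsingleton (T i)) (hd : ∀ i, Function.Exact (d i) (d (i + 1))) (i : ℕ) :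
    InAdd A M (LinearMap.range (d i)) := by
  -- Induction from the right end, where the ranges vanish.
  suffices ∀ k i, s ≤ i + k → InAdd A M (LinearMap.range (d i)) from this s i (by omega)
  clear i
  intro k
  induction k with
  | zero =>
    intro i hi
    have := hs (i + 1) (by omega)
    exact InAdd.of_subsingleton
  | succ k ih =>
    intro i hi
    have hex : Function.Exact (d i) (d (i + 1)).rangeRestrict := fun y => by
      rw [← hd i y, ← Subtype.val_inj]
      rfl
    obtain ⟨t, ht⟩ := hE.exists_section (hT i) (hT (i + 1)) (ih (i + 1) (by omega)) hex
      (LinearMap.surjective_rangeRestrict _)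
    -- The idempotent `1 - t ∘ d (i + 1)` projects onto the kernel of `d (i + 1)`, which is the
    -- range of `d i`.
    refine (hT (i + 1)).of_retract (LinearMap.range (d i)).subtype
      (LinearMap.codRestrict _ (LinearMap.id - t ∘ₗ (d (i + 1)).rangeRestrict) fun y => ?_) ?_
    · apply (hex _).1
      have := LinearMap.congr_fun ht ((d (i + 1)).rangeRestrict y)
      simp only [LinearMap.comp_apply, LinearMap.id_apply] at this
      simp [this]
    · ext ⟨y, hy⟩
      have : (d (i + 1)).rangeRestrict y = 0 := (hex y).2 hy
      change y - t ((d (i + 1)).rangeRestrict y) = y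
      rw [this, map_zero, sub_zero]

end Coresolution

/-! ### Approximations, extension groups and minimality. -/

section Approximation

variable {A : Type u} [Ring A] {M : Type u} [AddCommGroup M] [Module A M]

theorem ModuleCat.ofHom_sum {N N' : Type u} [AddCommGroup N] [Module A N] [AddCommGroup N']
    [Module A N'] {ι : Type*} (s : Finset ι) (f : ι → (N →ₗ[A] N')) :
    ModuleCat.ofHom (∑ i ∈ s, f i) = ∑ i ∈ s, ModuleCat.ofHom (f i) :=
  map_sum (ModuleCat.homAddEquiv (M := ModuleCat.of A N) (N := ModuleCat.of A N')).symm f s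

theorem InAdd.subsingleton_ext {N : Type u} [AddCommGroup N] [Module A N] (hN : InAdd A M N)
    {Y : ModuleCat.{u} A} {k : ℕ}
    (h : Subsingleton (Abelian.Ext.{u} (ModuleCat.of A M) Y k)) :
    Subsingleton (Abelian.Ext.{u} (ModuleCat.of A N) Y k) := by
  obtain ⟨n, i, p, hpi⟩ := hN
  refine subsingleton_of_forall_eq 0 fun x => ?_
  have hid : 𝟙 (ModuleCat.of A N) = ∑ t, ModuleCat.ofHom (LinearMap.proj t ∘ₗ i) ≫
      ModuleCat.ofHom (p ∘ₗ LinearMap.single A (fun _ => M) t) := by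
    simp only [← ModuleCat.ofHom_comp, ← ModuleCat.ofHom_sum]
    ext y
    conv_lhs => rw [ModuleCat.hom_id, ← hpi, LinearMap.comp_apply,
      ← LinearMap.sum_single_apply _ (i y), map_sum]
    simp
  rw [← Abelian.Ext.mk₀_id_comp x, hid, Abelian.Ext.mk₀_sum, Abelian.Ext.sum_comp]
  refine Finset.sum_eq_zero fun t _ => ?_
  rw [← Abelian.Ext.mk₀_comp_mk₀_assoc]
  rw [Subsingleton.elim ((Abelian.Ext.mk₀ _).comp x _) 0, Abelian.Ext.comp_zero]

theorem exists_extension_of_subsingleton_ext {X Y Z N : Type u} [AddCommGroup X] [Module A X]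
    [AddCommGroup Y] [Module A Y] [AddCommGroup Z] [Module A Z] [AddCommGroup N] [Module A N]
    {f : X →ₗ[A] Y} {g : Y →ₗ[A] Z} (hf : Function.Injective f) (hfg : Function.Exact f g)
    (hg : Function.Surjective g)
    (h : Subsingleton (Abelian.Ext.{u} (ModuleCat.of A Z) (ModuleCat.of A N) 1))
    (φ : X →ₗ[A] N) : ∃ ψ : Y →ₗ[A] N, ψ ∘ₗ f = φ := by
  have hS := ModuleCat.shortComplex_shortExact
    (ModuleCat.shortComplexOfCompEqZero f g hfg.linearMap_comp_eq_zero) hfg hf hg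
  obtain ⟨x, hx⟩ := Abelian.Ext.contravariant_sequence_exact₁ hS (ModuleCat.of A N)
    (Abelian.Ext.mk₀ (ModuleCat.ofHom φ)) (n₁ := 1) rfl (Subsingleton.elim _ _)
  obtain ⟨ψ, rfl⟩ := Abelian.Ext.addEquiv₀.symm.surjective x
  refine ⟨ψ.hom, ?_⟩
  rw [Abelian.Ext.addEquiv₀_symm_apply, Abelian.Ext.mk₀_comp_mk₀] at hx
  exact congrArg ModuleCat.Hom.hom ((Abelian.Ext.mk₀_bijective _ _).1 hx)

/-- To be a left `add M`-approximation can be tested on homomorphisms to `M`. -/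
theorem isLeftAddApproximation_of_forall {X D : Type u} [AddCommGroup X] [Module A X]
    [AddCommGroup D] [Module A D] {f : X →ₗ[A] D} (hD : InAdd A M D)
    (h : ∀ φ : X →ₗ[A] M, ∃ ψ : D →ₗ[A] M, ψ ∘ₗ f = φ) : IsLeftAddApproximation A M f := by
  refine ⟨hD, fun D' _ _ ⟨n, i, p, hpi⟩ φ => ?_⟩
  choose ψ hψ using fun t => h (LinearMap.proj t ∘ₗ i ∘ₗ φ)
  refine ⟨p ∘ₗ LinearMap.pi ψ, ?_⟩
  have : LinearMap.pi ψ ∘ₗ f = i ∘ₗ φ := by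
    ext x t
    exact LinearMap.congr_fun (hψ t) x
  rw [LinearMap.comp_assoc, this, ← LinearMap.comp_assoc, hpi, LinearMap.id_comp]

theorem InAdd.module_finite [Module.Finite A M] {N : Type u}
    [AddCommGroup N] [Module A N] (hN : InAdd A M N) : Module.Finite A N := by
  obtain ⟨n, i, p, hpi⟩ := hN
  exact Module.Finite.of_surjective p fun y => ⟨i y, LinearMap.congr_fun hpi y⟩

/-- The target of a homomorphism `f` to a module of finite length has a direct summand on which
`f` becomes left minimal. -/
theorem exists_retract_isLeftMinimal {X D : Type u} [AddCommGroup X] [Module A X]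
    [AddCommGroup D] [Module A D] [IsNoetherian A D] [IsArtinian A D] (f : X →ₗ[A] D) :
    ∃ (D' : Submodule A D) (p : D →ₗ[A] D') (f' : X →ₗ[A] D'),
      p ∘ₗ D'.subtype = LinearMap.id ∧ D'.subtype ∘ₗ f' = f ∧ IsLeftMinimal f' := by
  obtain ⟨D', ⟨hfD, p, hp⟩, hmin⟩ := IsArtinian.set_has_minimal
    {D' : Submodule A D | LinearMap.range f ≤ D' ∧
      ∃ p : D →ₗ[A] D', p ∘ₗ D'.subtype = LinearMap.id}
    ⟨⊤, le_top, LinearMap.codRestrict ⊤ LinearMap.id fun _ => trivial, rfl⟩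
  refine ⟨D', p, f.codRestrict D' fun x => hfD ⟨x, rfl⟩, hp, rfl, fun g hg => ?_⟩
  -- Fitting's lemma; `n ≥ 1` lets bijectivity pass from `g ^ n` to `g`.
  obtain ⟨n, hn, hcompl⟩ := ((Filter.eventually_ge_atTop 1).and
    (LinearMap.eventually_isCompl_ker_pow_range_pow g)).exists
  have hgn : (g ^ n) ∘ₗ f.codRestrict D' (fun x => hfD ⟨x, rfl⟩) =
      f.codRestrict D' fun x => hfD ⟨x, rfl⟩ := by
    clear hn hcompl
    induction n with
    | zero => rfl
    | succ n ih =>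
      rw [pow_succ, Module.End.mul_eq_comp, LinearMap.comp_assoc, hg, ih]
  -- The image of `g ^ n` is again a summand containing the image of `f`, so minimality of `D'`
  -- forces equality.
  set D'' := (LinearMap.range (g ^ n)).map D'.subtype with hD''
  have hle : D'' ≤ D' := by
    rintro _ ⟨y, -, rfl⟩
    exact y.2
  have hmem : D'' ∈ {D' : Submodule A D | LinearMap.range f ≤ D' ∧
      ∃ p : D →ₗ[A] D', p ∘ₗ D'.subtype = LinearMap.id} := by
    refine ⟨?_, ?_⟩
    · rintro _ ⟨x, rfl⟩
      exact ⟨f.codRestrict D' (fun x => hfD ⟨x, rfl⟩) x, ⟨_, LinearMap.congr_fun hgn x⟩, rfl⟩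
    · let q := Submodule.projectionOnto _ _ hcompl.symm
      refine ⟨LinearMap.codRestrict D'' (D'.subtype ∘ₗ Submodule.subtype _ ∘ₗ q ∘ₗ p)
        fun y => ⟨_, (q (p y)).2, rfl⟩, ?_⟩
      ext ⟨_, y, hy, rfl⟩
      have hpy : p (D'.subtype y) = y := LinearMap.congr_fun hp y
      change D'.subtype (q (p (D'.subtype y))) = D'.subtype y
      rw [hpy, Submodule.projectionOnto_apply_of_mem_left hcompl.symm hy]
  have heq : D'' = D' := by
    by_contra hne
    exact hmin D'' hmem (lt_of_le_of_ne hle hne)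
  have htop : LinearMap.range (g ^ n) = ⊤ := by
    refine eq_top_iff.2 fun y _ => ?_
    obtain ⟨z, hz, hzy⟩ := heq.ge y.2
    rwa [← Subtype.ext hzy]
  have hbot : LinearMap.ker (g ^ n) = ⊥ := by
    simpa [htop] using hcompl.inf_eq_bot
  obtain ⟨m, hm⟩ : ∃ m, n = m + 1 := ⟨n - 1, by omega⟩
  rw [hm] at htop hbot
  constructor
  · have := LinearMap.ker_eq_bot.1 hbot
    rw [pow_succ] at this
    exact Function.Injective.of_comp this
  · have := LinearMap.range_eq_top.1 htop
    rw [pow_succ'] at this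
    exact Function.Surjective.of_comp this

end Approximation

/-! ### From a tilting module to the minimal approximation sequence. -/

section TiltingToSequence

variable {A : Type u} [Ring A] {M : Type u} [AddCommGroup M] [Module A M]

theorem IsTiltingModule.exists_minimal_approximation [IsNoetherianRing A] [IsArtinianRing A]
    [Module.Finite A M] (hE : IsHereditary (Module.End A M)) (h : IsTiltingModule A M) :
    ∃ (M₀ M₁ : ModuleCat.{u} A) (f : A →ₗ[A] M₀) (g : M₀ →ₗ[A] M₁),
      InAdd A M M₀ ∧ InAdd A M M₁ ∧
      Function.Injective f ∧ Function.Exact f g ∧ Function.Surjective g ∧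
      IsLeftAddApproximation A M f ∧ IsLeftMinimal f := by
  obtain ⟨s, T, ε, d, hT, hs, hε, hεd, hd⟩ := h.coresolution
  have hZ := hE.inAdd_range hT hs hd 0
  have hex : Function.Exact ε (d 0).rangeRestrict := fun y => by
    rw [← hεd y, ← Subtype.val_inj]
    rfl
  have happ : IsLeftAddApproximation A M ε := isLeftAddApproximation_of_forall (hT 0)
    (exists_extension_of_subsingleton_ext hε hex (LinearMap.surjective_rangeRestrict _)
      (hZ.subsingleton_ext (h.ext_eq_zero 1 one_pos)))
  have := (hT 0).module_finite
  obtain ⟨D, p, f, hp, hf, hmin⟩ := exists_retract_isLeftMinimal ε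
  have hpε : p ∘ₗ ε = f := by
    rw [← hf, ← LinearMap.comp_assoc, hp, LinearMap.id_comp]
  have hD := (hT 0).of_retract _ _ hp
  have hfinj : Function.Injective f := by
    rw [← hf, LinearMap.coe_comp] at hε
    exact Function.Injective.of_comp hε
  have hfex : Function.Exact f (LinearMap.range f).mkQ := LinearMap.exact_iff.2 (by simp)
  -- The inclusion and projection of the summand `D` induce maps on cokernels, so the new cokernel
  -- is a retract of the range of `d 0`.
  obtain ⟨i, hi⟩ := LinearMap.exists_comp_eq_of_exact hfex (Submodule.mkQ_surjective _)
    ((d 0).rangeRestrict ∘ₗ D.subtype) (by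
      rw [LinearMap.comp_assoc, hf, hex.linearMap_comp_eq_zero])
  obtain ⟨q, hq⟩ := LinearMap.exists_comp_eq_of_exact hex (LinearMap.surjective_rangeRestrict _)
    ((LinearMap.range f).mkQ ∘ₗ p) (by
      rw [LinearMap.comp_assoc, hpε, hfex.linearMap_comp_eq_zero])
  have hqi : q ∘ₗ i = LinearMap.id := by
    apply Submodule.linearMap_qext
    rw [LinearMap.comp_assoc, hi, ← LinearMap.comp_assoc, hq, LinearMap.comp_assoc, hp]
    rfl
  refine ⟨ModuleCat.of A D, ModuleCat.of A (D ⧸ LinearMap.range f), f, (LinearMap.range f).mkQ,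
    hD, hZ.of_retract i q hqi, hfinj, hfex, Submodule.mkQ_surjective _,
    isLeftAddApproximation_of_forall hD fun φ => ?_, hmin⟩
  obtain ⟨ψ, hψ⟩ := happ.2 M inAdd_self φ
  exact ⟨ψ ∘ₗ D.subtype, by rw [LinearMap.comp_assoc, hf, hψ]⟩

end TiltingToSequence

/-! ### The Happel–Ringel splitting argument. -/

section Hereditary

/-- A splitting argument of Happel and Ringel: over a hereditary ring, let `lam : F → B` be a
surjection from a finitely generated projective module, and let `rho : Y → B` be such that every
map from the kernel of `lam` to `Y` extends to `F`. Then the inclusion of the image of `rho` in `B`,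
composed with a suitable endomorphism of `B`, agrees with the identity up to a map which
factors through `rho`. -/
theorem IsHereditary.exists_range_decomposition {E : Type u} [Ring E] (hE : IsHereditary E)
    {F : Type u} [AddCommGroup F] [Module E F] [Module.Finite E F] [Module.Projective E F]
    {B Y : Type u} [AddCommGroup B] [Module E B] [AddCommGroup Y] [Module E Y]
    (lam : F →ₗ[E] B) (hlam : Function.Surjective lam) (rho : Y →ₗ[E] B)
    (hext : ∀ θ : LinearMap.ker lam →ₗ[E] Y,
      ∃ τ : F →ₗ[E] Y, τ ∘ₗ (LinearMap.ker lam).subtype = θ) :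
    ∃ (σ : LinearMap.range rho →ₗ[E] Y) (κ : B →ₗ[E] B), (∀ b, κ b ∈ LinearMap.range rho) ∧
      ∀ c : LinearMap.range rho, (c : B) = rho (σ c) + κ c := by
  let Ω := (LinearMap.range rho).comap lam
  have := hE F Ω
  let lamΩ : Ω →ₗ[E] LinearMap.range rho := lam.restrict fun _ h => h
  have hlamΩ : Function.Surjective lamΩ := fun ⟨c, hc⟩ => by
    obtain ⟨ω, rfl⟩ := hlam c
    exact ⟨⟨ω, hc⟩, rfl⟩
  obtain ⟨μ, hμ⟩ := Module.projective_lifting_property rho.rangeRestrict lamΩ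
    (LinearMap.surjective_rangeRestrict _)
  have hμ' (ω : Ω) : rho (μ ω) = lam ω := congrArg Subtype.val (LinearMap.congr_fun hμ ω)
  have hle : LinearMap.ker lam ≤ Ω := fun x hx => by
    change lam x ∈ LinearMap.range rho
    rw [LinearMap.mem_ker.1 hx]
    exact zero_mem _
  obtain ⟨τ, hτ⟩ := hext (μ ∘ₗ Submodule.inclusion hle)
  have hτ' (x : LinearMap.ker lam) : τ x = μ (Submodule.inclusion hle x) :=
    LinearMap.congr_fun hτ x
  have hexΩ : Function.Exact (Submodule.inclusion hle) lamΩ := fun ω => by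
    constructor
    · intro h
      exact ⟨⟨ω, congrArg Subtype.val h⟩, rfl⟩
    · rintro ⟨x, rfl⟩
      exact Subtype.ext x.2
  -- Both `μ - τ` and `rho ∘ τ` vanish on the kernel of `lam`, the latter because `rho ∘ μ = lam`
  -- there; they descend to `σ` and `κ`.
  obtain ⟨σ, hσ⟩ := LinearMap.exists_comp_eq_of_exact hexΩ hlamΩ (μ - τ ∘ₗ Ω.subtype) (by
    ext x
    simp [hτ'])
  have hex : Function.Exact (LinearMap.ker lam).subtype lam := LinearMap.exact_iff.2 (by simp)
  obtain ⟨κ, hκ⟩ := LinearMap.exists_comp_eq_of_exact hex hlam (rho ∘ₗ τ) (by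
    ext x
    have := x.2
    simp_all)
  have hκ' (x : F) : κ (lam x) = rho (τ x) := LinearMap.congr_fun hκ x
  refine ⟨σ, κ, fun b => ?_, fun c => ?_⟩
  · obtain ⟨x, rfl⟩ := hlam b
    exact ⟨τ x, (hκ' x).symm⟩
  · obtain ⟨ω, rfl⟩ := hlamΩ c
    have hσω : σ (lamΩ ω) = μ ω - τ ω := LinearMap.congr_fun hσ ω
    change lam ω = rho (σ (lamΩ ω)) + κ (lam ω)
    rw [hσω, hκ', map_sub, hμ', sub_add_cancel]

end Hereditary

/-! ### Full faithfulness of Hom(-, M) on modules with a copresentation. -/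

section SequenceToTilting

variable {A : Type u} [Ring A] {M : Type u} [AddCommGroup M] [Module A M]

theorem InAdd.pi {N : Type u} [AddCommGroup N] [Module A N] (hN : InAdd A M N) (k : ℕ) :
    InAdd A M (Fin k → N) := by
  obtain ⟨m, i, p, hpi⟩ := hN
  have hpi' (y : N) : p (i y) = y := LinearMap.congr_fun hpi y
  let e : (Fin (k * m) → M) ≃ₗ[A] (Fin k → Fin m → M) :=
    (LinearEquiv.funCongrLeft A M finProdFinEquiv).trans (LinearEquiv.curry A M (Fin k) (Fin m))
  refine ⟨k * m, e.symm.toLinearMap ∘ₗ LinearMap.pi fun j => i ∘ₗ LinearMap.proj j,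
    (LinearMap.pi fun j => p ∘ₗ LinearMap.proj j) ∘ₗ e.toLinearMap, LinearMap.ext fun y => ?_⟩
  ext j
  simp [hpi']

variable (A M) in
/-- `P` embeds into a module in `add M` with cokernel in `add M`, in such a way that all
homomorphisms from `P` to `M` extend. -/
def HasAddCopresentation (P : Type u) [AddCommGroup P] [Module A P] : Prop :=
  ∃ (N₀ N₁ : ModuleCat.{u} A) (f : P →ₗ[A] N₀) (g : N₀ →ₗ[A] N₁),
    InAdd A M N₀ ∧ InAdd A M N₁ ∧
    Function.Injective f ∧ Function.Exact f g ∧ Function.Surjective g ∧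
    ∀ φ : P →ₗ[A] M, ∃ ψ : N₀ →ₗ[A] M, ψ ∘ₗ f = φ

theorem HasAddCopresentation.pi {P : Type u} [AddCommGroup P] [Module A P]
    (h : HasAddCopresentation A M P) (k : ℕ) : HasAddCopresentation A M (Fin k → P) := by
  obtain ⟨N₀, N₁, f, g, h₀, h₁, hf, hfg, hg, hext⟩ := h
  refine ⟨ModuleCat.of A (Fin k → N₀), ModuleCat.of A (Fin k → N₁),
    LinearMap.pi fun j => f ∘ₗ LinearMap.proj j, LinearMap.pi fun j => g ∘ₗ LinearMap.proj j,
    h₀.pi k, h₁.pi k, fun x y hxy => funext fun j => hf (congrFun hxy j), fun y => ?_, fun y => ?_,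
    fun φ => ?_⟩
  · constructor
    · intro hy
      choose x hx using fun j => (hfg (y j)).1 (congrFun hy j)
      exact ⟨x, funext hx⟩
    · rintro ⟨x, rfl⟩
      exact funext fun j => hfg.apply_apply_eq_zero (x j)
  · choose x hx using fun j => hg (y j)
    exact ⟨x, funext hx⟩
  · choose ψ hψ using fun j => hext (φ ∘ₗ LinearMap.single A (fun _ => P) j)
    refine ⟨∑ j, ψ j ∘ₗ LinearMap.proj j, LinearMap.ext fun x => ?_⟩
    have (j : Fin k) : ψ j (f (x j)) = φ (Pi.single j (x j)) := LinearMap.congr_fun (hψ j) (x j)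
    conv_rhs => rw [← LinearMap.sum_single_apply _ x, map_sum]
    simp [this]

theorem HasAddCopresentation.eq_of_forall {P : Type u} [AddCommGroup P] [Module A P]
    (h : HasAddCopresentation A M P) {x y : P} (hxy : ∀ φ : P →ₗ[A] M, φ x = φ y) : x = y := by
  obtain ⟨N₀, N₁, f, g, h₀, h₁, hf, hfg, hg, hext⟩ := h
  exact hf (h₀.eq_of_forall fun ψ => hxy (ψ ∘ₗ f))

/-- Every `End(M)`-linear functional `Hom(P, M) → M` is an evaluation. -/
theorem HasAddCopresentation.exists_eval {P : Type u} [AddCommGroup P] [Module A P]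
    (h : HasAddCopresentation A M P) (θ : (P →ₗ[A] M) →ₗ[Module.End A M] M) :
    ∃ x : P, ∀ φ, θ φ = φ x := by
  obtain ⟨N₀, N₁, f, g, h₀, h₁, hf, hfg, hg, hext⟩ := h
  obtain ⟨y, hy⟩ := h₀.exists_eval (θ ∘ₗ homPrecomp f)
  obtain ⟨x, rfl⟩ := (hfg y).1 (h₁.eq_of_forall fun ψ => by
    have := hy (ψ ∘ₗ g)
    rw [LinearMap.comp_apply, homPrecomp_apply, LinearMap.comp_assoc,
      hfg.linearMap_comp_eq_zero, LinearMap.comp_zero, map_zero] at this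
    rw [map_zero, this, LinearMap.comp_apply])
  refine ⟨x, fun φ => ?_⟩
  obtain ⟨ψ, rfl⟩ := hext φ
  exact hy ψ

/-- Every `End(M)`-linear map `Hom(P, M) → Hom(Q, M)` is induced by a map `Q → P`. -/
theorem HasAddCopresentation.exists_eq_homPrecomp {P Q : Type u} [AddCommGroup P] [Module A P]
    [AddCommGroup Q] [Module A Q] (h : HasAddCopresentation A M P)
    (Θ : (P →ₗ[A] M) →ₗ[Module.End A M] (Q →ₗ[A] M)) :
    ∃ s : Q →ₗ[A] P, Θ = homPrecomp s := by
  have heval (z : Q) : ∃ x : P, ∀ φ : P →ₗ[A] M, Θ φ z = φ x :=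
    h.exists_eval ⟨⟨fun φ => Θ φ z, fun φ φ' => by rw [map_add]; rfl⟩,
      fun c φ => by simp only [map_smul]; rfl⟩
  choose s hs using heval
  refine ⟨⟨⟨s, fun z z' => h.eq_of_forall fun φ => ?_⟩, fun a z => h.eq_of_forall fun φ => ?_⟩,
    LinearMap.ext fun φ => LinearMap.ext fun z => hs z φ⟩
  · rw [← hs, map_add, map_add, hs, hs]
  · simp only [RingHom.id_apply]
    rw [← hs, map_smul, map_smul, hs]

/-- Let `P` have an `add M`-copresentation `P → N₀`. Every homomorphism of `End(M)`-modules from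
the kernel of `Hom(N₀, M) → Hom(P, M)` to `Hom(Aⁿ, M)` extends to `Hom(N₀, M)`. -/
theorem exists_extension_ker_homPrecomp {P N₀ N₁ : Type u} [AddCommGroup P] [Module A P]
    [AddCommGroup N₀] [Module A N₀] [AddCommGroup N₁] [Module A N₁] {f : P →ₗ[A] N₀}
    {g : N₀ →ₗ[A] N₁} (h₁ : InAdd A M N₁) (hfg : Function.Exact f g) (hg : Function.Surjective g)
    {n : ℕ} (θ : LinearMap.ker (homPrecomp (M := M) f) →ₗ[Module.End A M]
      ((Fin n → A) →ₗ[A] M)) :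
    ∃ τ : (N₀ →ₗ[A] M) →ₗ[Module.End A M] ((Fin n → A) →ₗ[A] M),
      τ ∘ₗ (LinearMap.ker (homPrecomp (M := M) f)).subtype = θ := by
  have hker (ψ : N₁ →ₗ[A] M) : homPrecomp g ψ ∈ LinearMap.ker (homPrecomp (M := M) f) := by
    rw [LinearMap.mem_ker, homPrecomp_apply, homPrecomp_apply, LinearMap.comp_assoc,
      hfg.linearMap_comp_eq_zero, LinearMap.comp_zero]
  let γ : (N₁ →ₗ[A] M) →ₗ[Module.End A M] LinearMap.ker (homPrecomp (M := M) f) :=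
    LinearMap.codRestrict _ (homPrecomp g) hker
  -- The kernel is Hom(N₁, M), so `θ` amounts to a map Aⁿ → N₁; freeness of Aⁿ lifts it to N₀.
  have heval (j : Fin n) : ∃ y : N₀, ∀ ψ : N₁ →ₗ[A] M, θ (γ ψ) (Pi.single j 1) = ψ (g y) := by
    obtain ⟨z, hz⟩ := h₁.exists_eval
      ⟨⟨fun ψ => θ (γ ψ) (Pi.single j 1), fun φ φ' => by rw [map_add, map_add]; rfl⟩,
        fun c φ => by simp only [map_smul]; rfl⟩
    obtain ⟨y, rfl⟩ := hg z
    exact ⟨y, hz⟩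
  choose y hy using heval
  refine ⟨homPrecomp (Fintype.linearCombination A y), LinearMap.ext fun ⟨φ, hφ⟩ => ?_⟩
  obtain ⟨ψ, rfl⟩ := LinearMap.exists_comp_eq_of_exact hfg hg φ hφ
  apply LinearMap.pi_ext'
  intro j
  ext
  have := hy j ψ
  simp only [LinearMap.comp_apply, homPrecomp_apply, LinearMap.coe_single,
    Fintype.linearCombination_apply_single, one_smul, Submodule.subtype_apply]
  exact this.symm

end SequenceToTilting

/-! ### The syzygy of M and the converse direction. -/

section SequenceToTilting

variable {A : Type u} [Ring A] {M : Type u} [AddCommGroup M] [Module A M]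

/-- The first syzygy of `M` is projective and its homomorphisms to `M` extend. -/
theorem HasAddCopresentation.syzygy (hE : IsHereditary (Module.End A M))
    (hA : HasAddCopresentation A M A) {n k : ℕ} {π : (Fin n → A) →ₗ[A] M}
    {η : (Fin k → A) →ₗ[A] (Fin n → A)} (hηπ : Function.Exact η π) :
    Module.Projective A (LinearMap.ker π) ∧
      ∀ φ : LinearMap.ker π →ₗ[A] M, ∃ ψ : (Fin n → A) →ₗ[A] M,
        ψ ∘ₗ (LinearMap.ker π).subtype = φ := by
  have hP := hA.pi n
  have hQ := hA.pi k
  obtain ⟨N₀, N₁, f, g, h₀, h₁, hf, hfg, hg, hext⟩ := hA.pi k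
  have := h₀.projective_hom
  have := h₀.finite_hom
  obtain ⟨σ, κ, hκ, hσκ⟩ := hE.exists_range_decomposition (homPrecomp (M := M) f) hext
    (homPrecomp (M := M) η) (exists_extension_ker_homPrecomp h₁ hfg hg)
  obtain ⟨S, hS⟩ := hP.exists_eq_homPrecomp (σ ∘ₗ (homPrecomp (M := M) η).rangeRestrict)
  obtain ⟨U, rfl⟩ := hQ.exists_eq_homPrecomp κ
  have hS' (y : (Fin n → A) →ₗ[A] M) : σ ((homPrecomp (M := M) η).rangeRestrict y) = y ∘ₗ S :=
    LinearMap.congr_fun hS y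
  -- The decomposition of the image of Hom(η, M), dualized: η = Sη + ηU.
  have hdec (x : Fin k → A) : η x = S (η x) + η (U x) := hP.eq_of_forall fun y => by
    have := LinearMap.congr_fun (hσκ ((homPrecomp (M := M) η).rangeRestrict y)) x
    rw [hS'] at this
    rw [map_add]
    exact this
  have hSker (x : Fin n → A) : S x ∈ LinearMap.ker π := by
    have h0 : (homPrecomp (M := M) η).rangeRestrict π = 0 :=
      Subtype.ext hηπ.linearMap_comp_eq_zero
    have := LinearMap.congr_fun (hS' π) x
    rw [h0, map_zero] at this
    exact this.symm
  let η' : (Fin k → A) →ₗ[A] LinearMap.ker π :=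
    η.codRestrict _ fun x => hηπ.apply_apply_eq_zero x
  have hη' : Function.Surjective η' := fun ⟨x, hx⟩ => by
    obtain ⟨z, rfl⟩ := (hηπ x).1 hx
    exact ⟨z, rfl⟩
  let S' : (Fin n → A) →ₗ[A] LinearMap.ker π := S.codRestrict _ hSker
  have hdec' (x : Fin k → A) : S' (η x) + η' (U x) = η' x := Subtype.ext (hdec x).symm
  have hexη : Function.Exact (LinearMap.ker η').subtype η' := LinearMap.exact_iff.2 (by simp)
  -- Since `κ` takes values in the image of Hom(η, M), every `w ∘ U` factors through `η`; hence `U`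
  -- kills the kernel of `η`.
  obtain ⟨V, hV⟩ := LinearMap.exists_comp_eq_of_exact hexη hη' U (by
    ext1 ⟨x, hx⟩
    refine hQ.eq_of_forall fun w => ?_
    obtain ⟨y, hy⟩ := hκ w
    have h1 := LinearMap.congr_fun hy x
    have h2 : η x = 0 := congrArg Subtype.val hx
    simp only [homPrecomp_apply, LinearMap.comp_apply, h2, map_zero] at h1
    simp [← h1])
  have hV' (x : Fin k → A) : V (η' x) = U x := LinearMap.congr_fun hV x
  constructor
  · refine Module.Projective.of_split (M := (Fin n → A) × (Fin k → A))
      ((LinearMap.ker π).subtype.prod V) (S'.coprod η') (LinearMap.ext fun r => ?_)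
    obtain ⟨x, rfl⟩ := hη' r
    simp only [LinearMap.comp_apply, LinearMap.prod_apply, Function.prod, LinearMap.coprod_apply,
      hV', LinearMap.id_apply]
    exact hdec' x
  · intro φ
    obtain ⟨y, hy⟩ := hκ (φ ∘ₗ η')
    refine ⟨φ ∘ₗ S' + y, LinearMap.ext fun r => ?_⟩
    obtain ⟨x, rfl⟩ := hη' r
    have h1 : y (η x) = φ (η' (U x)) := LinearMap.congr_fun hy x
    change φ (S' (η x)) + y (η x) = φ (η' x)
    rw [h1, ← map_add, hdec']

/-- If the homomorphisms from a projective first syzygy of `M` to `M` extend, then `M` has projective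
dimension at most one and no self-extensions. -/
theorem rigid_of_syzygy {P : Type u} [AddCommGroup P] [Module A P] [Module.Projective A P]
    {π : P →ₗ[A] M} (hπ : Function.Surjective π) (hproj : Module.Projective A (LinearMap.ker π))
    (hext : ∀ φ : LinearMap.ker π →ₗ[A] M, ∃ ψ : P →ₗ[A] M,
      ψ ∘ₗ (LinearMap.ker π).subtype = φ) :
    HasProjectiveDimensionLE (ModuleCat.of A M) 1 ∧ ∀ i : ℕ, 0 < i →
      Subsingleton (Abelian.Ext.{u} (ModuleCat.of A M) (ModuleCat.of A M) i) := by
  have hS := LinearMap.shortExact_shortComplexKer hπ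
  have h₁ : Projective π.shortComplexKer.X₁ := (IsProjective.iff_projective _).1 hproj
  have h₂ : Projective π.shortComplexKer.X₂ :=
    (IsProjective.iff_projective P).1 inferInstance
  have hpd : HasProjectiveDimensionLE (ModuleCat.of A M) 1 :=
    hS.hasProjectiveDimensionLT_X₃ 1 inferInstance inferInstance
  refine ⟨hpd, fun i hi => ?_⟩
  obtain rfl | hi := Nat.eq_or_lt_of_le (Nat.succ_le_of_lt hi)
  · refine subsingleton_of_forall_eq 0 fun x => ?_
    -- A class in Ext¹ comes from a map on the syzygy; as that map extends to `P`, the class is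
    -- zero.
    obtain ⟨y, rfl⟩ := Abelian.Ext.contravariant_sequence_exact₃ hS (ModuleCat.of A M) x
      (Abelian.Ext.eq_zero_of_projective _) (n₀ := 0) rfl
    obtain ⟨φ, rfl⟩ := Abelian.Ext.addEquiv₀.symm.surjective y
    obtain ⟨ψ, hψ⟩ := hext φ.hom
    have hφ : φ = π.shortComplexKer.f ≫ ModuleCat.ofHom ψ := ModuleCat.hom_ext hψ.symm
    rw [Abelian.Ext.addEquiv₀_symm_apply, hφ, ← Abelian.Ext.mk₀_comp_mk₀,
      hS.extClass_comp_assoc]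
  · exact HasProjectiveDimensionLT.subsingleton _ 2 i hi _

theorem hasFiniteAddCoresolution_of_exact {M₀ M₁ : ModuleCat.{u} A} {f : A →ₗ[A] M₀}
    {g : M₀ →ₗ[A] M₁} (h₀ : InAdd A M M₀) (h₁ : InAdd A M M₁) (hf : Function.Injective f)
    (hfg : Function.Exact f g) (hg : Function.Surjective g) : HasFiniteAddCoresolution A M := by
  let T : ℕ → ModuleCat.{u} A
    | 0 => M₀
    | 1 => M₁
    | _ + 2 => ModuleCat.of A PUnit
  let d : ∀ i, T i →ₗ[A] T (i + 1)
    | 0 => g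
    | _ + 1 => 0
  have hsub (i : ℕ) : Subsingleton (T (i + 2)) := inferInstanceAs (Subsingleton PUnit)
  refine ⟨1, T, f, d, ?_, ?_, hf, hfg, ?_⟩
  · rintro (_ | _ | i)
    · exact h₀
    · exact h₁
    · exact InAdd.of_subsingleton (N := PUnit)
  · rintro (_ | _ | i) hi
    · omega
    · omega
    · exact hsub i
  · rintro (_ | i) y
    · exact ⟨fun _ => hg y, fun _ => rfl⟩
    · have := hsub i
      exact ⟨fun _ => ⟨0, Subsingleton.elim (α := T (i + 2)) _ _⟩, fun _ => rfl⟩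

theorem isTiltingModule_of_exact [IsNoetherianRing A] [Module.Finite A M]
    (hE : IsHereditary (Module.End A M)) {M₀ M₁ : ModuleCat.{u} A} {f : A →ₗ[A] M₀}
    {g : M₀ →ₗ[A] M₁} (h₀ : InAdd A M M₀) (h₁ : InAdd A M M₁) (hf : Function.Injective f)
    (hfg : Function.Exact f g) (hg : Function.Surjective g)
    (happ : IsLeftAddApproximation A M f) : IsTiltingModule A M := by
  have hA : HasAddCopresentation A M A :=
    ⟨M₀, M₁, f, g, h₀, h₁, hf, hfg, hg, happ.2 M inAdd_self⟩
  obtain ⟨n, π, hπ⟩ := Module.Finite.exists_fin' A M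
  obtain ⟨k, ζ, hζ⟩ := Module.Finite.exists_fin' A (LinearMap.ker π)
  have hex : Function.Exact ((LinearMap.ker π).subtype ∘ₗ ζ) π := by
    rw [LinearMap.exact_iff, LinearMap.range_comp, LinearMap.range_eq_top.2 hζ]
    simp
  obtain ⟨hproj, hext⟩ := hA.syzygy hE hex
  obtain ⟨hpd, hExt⟩ := rigid_of_syzygy hπ hproj hext
  exact ⟨⟨1, hpd⟩, hExt, hasFiniteAddCoresolution_of_exact h₀ h₁ hf hfg hg⟩

end SequenceToTilting

theorem mainTheorem8 (K : Type*) [Field K] (A : Type u) [Ring A] [Algebra K A]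
    [Module.Finite K A] (M : Type u) [AddCommGroup M] [Module A M] [Module.Finite A M]
    (hM : IsHereditary (Module.End A M)) :
    IsTiltingBimodule A M (Module.End A M) ↔
      ∃ (M₀ M₁ : ModuleCat.{u} A) (f : A →ₗ[A] M₀) (g : M₀ →ₗ[A] M₁),
        InAdd A M M₀ ∧ InAdd A M M₁ ∧
        Function.Injective f ∧ Function.Exact f g ∧ Function.Surjective g ∧
        IsLeftAddApproximation A M f ∧ IsLeftMinimal f := by
  have : IsArtinianRing A := IsArtinianRing.of_finite K A
  refine ⟨fun h => h.isTiltingModule.exists_minimal_approximation hM, ?_⟩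
  rintro ⟨M₀, M₁, f, g, h₀, h₁, hf, hfg, hg, happ, -⟩
  exact ⟨isTiltingModule_of_exact hM h₀ h₁ hf hfg hg happ, Function.bijective_id⟩
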